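/- For complex $x,q$ and $n\ge 0$ put $(x;q)_n=\prod_{i=0}^{n-1}(1-q^i x)$. For $|q|<1$ let $$\phi_D(q)=\sum_{n\ge0}\frac{(-1)^{n+1}q^{\binom{n+2}{2}}}{(q;q^2)_{n+1}},\quad \psi_D(q)=\sum_{n\ge0}\frac{(-1)^{n+1}q^{\binom{n+1}{2}}}{(q;q^2)_{n+1}},\quad X_D(q)=\sum_{n\ge0}\frac{(-1)^nq^{n(n+1)}}{(-q;q)_{2n}},\quad \chi_D(q)=\sum_{n\ge0}\frac{(-1)^nq^{n(n+1)}}{(-q;q)_{2n+1}}$$ be the duals of the tenth order mock theta functions, obtained by replacing $q$ by $q^{-1}$ in each term of, respectively, $\phi(q)=\sum_{n\ge0}\frac{q^{\binom{n+1}{2}}}{(q;q^2)_{n+1}}$, $\psi(q)=\sum_{n\ge0}\frac{q^{\binom{n+2}{2}}}{(q;q^2)_{n+1}}$, $X(q)=\sum_{n\ge0}\frac{(-1)^nq^{n^2}}{(-q;q)_{2n}}$, $\chi(q)=\sum_{n\ge0}\frac{(-1)^nq^{(n+1)^2}}{(-q;q)_{2n+1}}$. These four dual series converge absolutely for $|q|<1$.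 Moreover, let $q$ be a complex number with $0<|q|<1$, let $q^{1/3}$ be any cube root of $q$, write $q^{\pm2/3}=(q^{1/3})^{\pm2}$, and let $\omega$ be a primitive cube root of unity. Then $$q^{-2/3}\phi_D(q^3)-\frac{\psi_D(\omega^2q^{1/3})-\psi_D(\omega q^{1/3})}{\omega-\omega^2}=0,$$ $$q^{2/3}\psi_D(q^3)+\frac{\omega\,\phi_D(\omega^2q^{1/3})-\omega^2\phi_D(\omega q^{1/3})}{\omega-\omega^2}=0,$$ $$X_D(q^3)-\frac{\omega\,\chi_D(\omega^2q^{1/3})-\omega^2\chi_D(\omega q^{1/3})}{\omega-\omega^2}=0,$$ $$\chi_D(q^3)+q^{-2/3}\,\frac{X_D(\omega^2q^{1/3})-X_D(\omega q^{1/3})}{\omega-\omega^2}=0.$$ -/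

import Mathlib

namespace TenthOrderDuals

/-- The finite `q`-Pochhammer symbol `(x; q)_n = ∏_{i=0}^{n-1} (1 - q^i x)`. -/
noncomputable def qPoch (x q : ℂ) (n : ℕ) : ℂ :=
  ∏ i ∈ Finset.range n, (1 - q ^ i * x)

/-- General term of `φ_D`, the dual of the tenth order mock theta function
`φ(q) = ∑ q^(n(n+1)/2) / (q; q²)_{n+1}`: replacing `q` by `q⁻¹` in the `n`-th term of `φ` gives
`(-1)^(n+1) q^((n+1)(n+2)/2) / (q; q²)_{n+1}`. -/
noncomputable def phiDTerm (q : ℂ) (n : ℕ) : ℂ :=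
  (-1) ^ (n + 1) * q ^ ((n + 2).choose 2) / qPoch q (q ^ 2) (n + 1)

/-- General term of `ψ_D`, the dual of the tenth order mock theta function
`ψ(q) = ∑ q^((n+1)(n+2)/2) / (q; q²)_{n+1}` (again by `q ↦ q⁻¹` in each term). -/
noncomputable def psiDTerm (q : ℂ) (n : ℕ) : ℂ :=
  (-1) ^ (n + 1) * q ^ ((n + 1).choose 2) / qPoch q (q ^ 2) (n + 1)

/-- General term of `X_D`, the dual of the tenth order mock theta function
`X(q) = ∑ (-1)^n q^(n²) / (-q; q)_{2n}` (again by `q ↦ q⁻¹` in each term). -/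
noncomputable def XDTerm (q : ℂ) (n : ℕ) : ℂ :=
  (-1) ^ n * q ^ (n * (n + 1)) / qPoch (-q) q (2 * n)

/-- General term of `χ_D`, the dual of the tenth order mock theta function
`χ(q) = ∑ (-1)^n q^((n+1)²) / (-q; q)_{2n+1}` (again by `q ↦ q⁻¹` in each term). -/
noncomputable def chiDTerm (q : ℂ) (n : ℕ) : ℂ :=
  (-1) ^ n * q ^ (n * (n + 1)) / qPoch (-q) q (2 * n + 1)

/-- `φ_D(q) = ∑_{n ≥ 0} (-1)^(n+1) q^((n+1)(n+2)/2) / (q; q²)_{n+1}`. -/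
noncomputable def phiD (q : ℂ) : ℂ := ∑' n : ℕ, phiDTerm q n

/-- `ψ_D(q) = ∑_{n ≥ 0} (-1)^(n+1) q^(n(n+1)/2) / (q; q²)_{n+1}`. -/
noncomputable def psiD (q : ℂ) : ℂ := ∑' n : ℕ, psiDTerm q n

/-- `X_D(q) = ∑_{n ≥ 0} (-1)^n q^(n(n+1)) / (-q; q)_{2n}`. -/
noncomputable def XD (q : ℂ) : ℂ := ∑' n : ℕ, XDTerm q n

/-- `χ_D(q) = ∑_{n ≥ 0} (-1)^n q^(n(n+1)) / (-q; q)_{2n+1}`. -/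
noncomputable def chiD (q : ℂ) : ℂ := ∑' n : ℕ, chiDTerm q n

end TenthOrderDuals

namespace TenthOrderDuals

/-! Each dual function is a combination of two partial theta series, and the four identities are
trisections of these. Writing P(A,B) for ∑ ε^n q^(5n²+An+B), one has ψ_D = -(P(2,0) + P(8,3)) and
φ_D = -(P(4,1) + P(6,2)) with ε = -1, while X_D(s²) = P(1,0) - P(9,4) and χ_D(s²) = P(3,0) - P(7,2)
with ε = 1 and P taken at s (`psiD_eq`, `phiD_eq`, `XD_sq_eq`, `chiD_sq_eq`).

The expansions come from the Bailey transform (`hasSum_mul_bilatSum`). The conjugate Bailey pair is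
a limiting q-Gauss sum (`hasSum_conjTerm`, `hasSum_baileyTerm`). The Bailey pairs say that bilateral
sums with weight (-1)^m q^(3m²+km) are reciprocal products (`bilatSum_two_odd_eq`,
`bilatSum_two_three_eq`, `bilatSum_one_eq`, `bilatSum_one_odd_neg_eq`); they follow from q-Pascal
recurrences and the symmetries of the weight.

For the trisection (`partialTheta_trisection`), the difference of the twists by ω² and ω kills every
n outside one class i mod 3. On n = 3k+i the exponent is, up to a fixed shift, 9(5k²+A'k+B'), which
is a partial theta series of the partner function at the ninth power. -/

/-! ### Bounds for q-Pochhammer symbols and absolute convergence -/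

theorem qPoch_succ (x q : ℂ) (n : ℕ) : qPoch x q (n + 1) = qPoch x q n * (1 - q ^ n * x) := by
  simp [qPoch, Finset.prod_range_succ]

@[simp] theorem qPoch_zero (x q : ℂ) : qPoch x q 0 = 1 := by simp [qPoch]

theorem one_sub_pow_mul_ne_zero {x q : ℂ} (hx : ‖x‖ < 1) (hq : ‖q‖ < 1) (i : ℕ) :
    1 - q ^ i * x ≠ 0 := by
  intro h
  have h1 : q ^ i * x = 1 := (sub_eq_zero.mp h).symm
  have h2 : ‖q ^ i * x‖ ≤ ‖x‖ := by
    rw [norm_mul, norm_pow]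
    exact mul_le_of_le_one_left (norm_nonneg _) (pow_le_one₀ (norm_nonneg _) hq.le)
  rw [h1, norm_one] at h2
  linarith

theorem qPoch_ne_zero {x q : ℂ} (hx : ‖x‖ < 1) (hq : ‖q‖ < 1) (n : ℕ) : qPoch x q n ≠ 0 :=
  Finset.prod_ne_zero_iff.mpr fun i _ => one_sub_pow_mul_ne_zero hx hq i

theorem sum_range_pow_le {r : ℝ} (h0 : 0 ≤ r) (h1 : r < 1) (n : ℕ) :
    ∑ i ∈ Finset.range n, r ^ i ≤ (1 - r)⁻¹ := by
  rw [← tsum_geometric_of_lt_one h0 h1]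
  exact (summable_geometric_of_lt_one h0 h1).sum_le_tsum _ fun i _ => pow_nonneg h0 i

theorem norm_qPoch_le {x q : ℂ} (hx : ‖x‖ < 1) (hq : ‖q‖ < 1) (n : ℕ) :
    ‖qPoch x q n‖ ≤ Real.exp (1 - ‖q‖)⁻¹ := by
  rw [qPoch, norm_prod]
  calc ∏ i ∈ Finset.range n, ‖1 - q ^ i * x‖
      ≤ ∏ i ∈ Finset.range n, Real.exp (‖q‖ ^ i) := by
        refine Finset.prod_le_prod (fun _ _ => norm_nonneg _) fun i _ => ?_
        have h1 : ‖1 - q ^ i * x‖ ≤ 1 + ‖q‖ ^ i * ‖x‖ := by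
          simpa using norm_sub_le (1 : ℂ) (q ^ i * x)
        have h2 : ‖q‖ ^ i * ‖x‖ ≤ ‖q‖ ^ i := mul_le_of_le_one_right (by positivity) hx.le
        linarith [Real.add_one_le_exp (‖q‖ ^ i)]
    _ = Real.exp (∑ i ∈ Finset.range n, ‖q‖ ^ i) := (Real.exp_sum _ _).symm
    _ ≤ _ := Real.exp_le_exp.mpr (sum_range_pow_le (norm_nonneg _) hq n)

/-- From 1/(1-y) = 1 + y/(1-y) ≤ exp(y/(1-y)), the product is at most the exponential of a geometric
series, uniformly in `n`. -/
theorem exists_norm_inv_qPoch_le {x q : ℂ} (hx : ‖x‖ < 1) (hq : ‖q‖ < 1) :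
    ∃ C : ℝ, 0 < C ∧ ∀ n, ‖(qPoch x q n)⁻¹‖ ≤ C := by
  refine ⟨Real.exp ((1 - ‖x‖)⁻¹ * (1 - ‖q‖)⁻¹), Real.exp_pos _, fun n => ?_⟩
  have hx' : 0 < 1 - ‖x‖ := by linarith
  rw [qPoch, norm_inv, norm_prod, ← Finset.prod_inv_distrib]
  calc ∏ i ∈ Finset.range n, ‖1 - q ^ i * x‖⁻¹
      ≤ ∏ i ∈ Finset.range n, Real.exp ((1 - ‖x‖)⁻¹ * ‖q‖ ^ i) := by
        refine Finset.prod_le_prod (fun _ _ => by positivity) fun i _ => ?_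
        have h1 : 1 - ‖q‖ ^ i * ‖x‖ ≤ ‖1 - q ^ i * x‖ := by
          simpa using norm_sub_norm_le (1 : ℂ) (q ^ i * x)
        have h2 : ‖q‖ ^ i * ‖x‖ ≤ ‖x‖ :=
          mul_le_of_le_one_left (norm_nonneg _) (pow_le_one₀ (norm_nonneg _) hq.le)
        have h3 : 0 < 1 - ‖q‖ ^ i * ‖x‖ := by linarith
        have h4 : ‖q‖ ^ i * ‖x‖ ≤ ‖q‖ ^ i := mul_le_of_le_one_right (by positivity) hx.le
        have h5 : 0 ≤ ‖q‖ ^ i * ‖x‖ := by positivity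
        calc ‖1 - q ^ i * x‖⁻¹ ≤ (1 - ‖q‖ ^ i * ‖x‖)⁻¹ := inv_anti₀ h3 h1
          _ = (1 - ‖q‖ ^ i * ‖x‖)⁻¹ * (‖q‖ ^ i * ‖x‖) + 1 := by field_simp; ring
          _ ≤ (1 - ‖x‖)⁻¹ * ‖q‖ ^ i + 1 := by gcongr
          _ ≤ _ := Real.add_one_le_exp _
    _ = Real.exp (∑ i ∈ Finset.range n, (1 - ‖x‖)⁻¹ * ‖q‖ ^ i) := (Real.exp_sum _ _).symm
    _ ≤ _ := by
      rw [← Finset.mul_sum]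
      gcongr
      exact sum_range_pow_le (norm_nonneg _) hq n

theorem summable_of_norm_le_mul_pow {f : ℕ → ℂ} {r C : ℝ} (h0 : 0 ≤ r) (h1 : r < 1)
    (hf : ∀ n, ‖f n‖ ≤ C * r ^ n) : Summable f :=
  Summable.of_norm_bounded ((summable_geometric_of_lt_one h0 h1).mul_left C) hf

theorem choose_two_succ_mul_two (n : ℕ) : (n + 1).choose 2 * 2 = n * (n + 1) := by
  induction n with
  | zero => rfl
  | succ n ih =>
    have := Nat.choose_succ_succ' (n + 1) 1
    simp only [Nat.choose_one_right, Nat.reduceAdd] at this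
    rw [this, add_mul, ih]
    ring

theorem le_choose_two_succ (n : ℕ) : n ≤ (n + 1).choose 2 := by
  have := choose_two_succ_mul_two n
  rcases n with _ | n
  · simp
  · nlinarith

theorem norm_pow_le_pow {q : ℂ} (hq : ‖q‖ < 1) {m n : ℕ} (h : m ≤ n) : ‖q ^ n‖ ≤ ‖q‖ ^ m := by
  rw [norm_pow]
  exact pow_le_pow_of_le_one (norm_nonneg _) hq.le h

theorem norm_sq_lt_one {q : ℂ} (hq : ‖q‖ < 1) : ‖q ^ 2‖ < 1 := by
  rw [norm_pow]
  exact pow_lt_one₀ (norm_nonneg _) hq two_ne_zero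

theorem summable_sign_mul_pow_div_qPoch {x p q : ℂ} (hx : ‖x‖ < 1) (hp : ‖p‖ < 1) (hq : ‖q‖ < 1)
    (k : ℕ) {e l : ℕ → ℕ} (he : ∀ n, n ≤ e n) :
    Summable fun n => (-1) ^ (n + k) * q ^ e n / qPoch x p (l n) := by
  obtain ⟨C, hC, h⟩ := exists_norm_inv_qPoch_le hx hp
  refine summable_of_norm_le_mul_pow (norm_nonneg q) hq (C := C) fun n => ?_
  rw [div_eq_mul_inv, norm_mul, norm_mul, norm_pow, norm_neg, norm_one, one_pow, one_mul, mul_comm]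
  exact mul_le_mul (h _) (norm_pow_le_pow hq (he n)) (norm_nonneg _) hC.le

theorem summable_phiDTerm {q : ℂ} (hq : ‖q‖ < 1) : Summable (phiDTerm q) :=
  summable_sign_mul_pow_div_qPoch hq (norm_sq_lt_one hq) hq 1
    fun n => (Nat.le_succ n).trans (le_choose_two_succ (n + 1))

theorem summable_psiDTerm {q : ℂ} (hq : ‖q‖ < 1) : Summable (psiDTerm q) :=
  summable_sign_mul_pow_div_qPoch hq (norm_sq_lt_one hq) hq 1 le_choose_two_succ

theorem summable_XDTerm {q : ℂ} (hq : ‖q‖ < 1) : Summable (XDTerm q) :=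
  summable_sign_mul_pow_div_qPoch (by rwa [norm_neg]) hq hq 0 fun n => by nlinarith

theorem summable_chiDTerm {q : ℂ} (hq : ‖q‖ < 1) : Summable (chiDTerm q) :=
  summable_sign_mul_pow_div_qPoch (by rwa [norm_neg]) hq hq 0 fun n => by nlinarith

/-! ### The conjugate Bailey pair -/

/-- The summand of the limiting `q`-Gauss sum behind the conjugate Bailey pair. -/
noncomputable def conjTerm (q : ℂ) (r k m : ℕ) : ℂ :=
  (-1) ^ m * q ^ ((m + 1).choose 2 + m * k) * qPoch q q (m + r) /
    (qPoch q q m * qPoch q q (m + r + k + 1))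

/-- Over a common denominator, with M = m+r+1, this is 1 - q^M = (1 - q^(M+k+1)) - q^M (1 -
q^(k+1)). -/
theorem conjTerm_succ {q : ℂ} (hq : ‖q‖ < 1) (r k m : ℕ) :
    conjTerm q (r + 1) k m =
      conjTerm q r k m - q ^ (r + 1) * (1 - q ^ (k + 1)) * conjTerm q r (k + 1) m := by
  have h := qPoch_ne_zero hq hq
  simp only [conjTerm]
  rw [show m + (r + 1) + k + 1 = (m + r + k + 1) + 1 by ring,
    show m + r + (k + 1) + 1 = (m + r + k + 1) + 1 by ring, ← add_assoc m r 1,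
    qPoch_succ q q (m + r + k + 1), qPoch_succ q q (m + r)]
  have h1 := h m
  have h2 := h (m + r + k + 1)
  have h3 := one_sub_pow_mul_ne_zero hq hq (m + r + k + 1)
  generalize hD : 1 - q ^ (m + r + k + 1) * q = D at h3 ⊢
  field_simp
  rw [← hD]
  ring

theorem hasSum_conjTerm_zero {q : ℂ} (hq : ‖q‖ < 1) (k : ℕ) :
    HasSum (conjTerm q 0 k) (qPoch q q k)⁻¹ := by
  have h := qPoch_ne_zero hq hq
  obtain ⟨C, hC, hinv⟩ := exists_norm_inv_qPoch_le hq hq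
  have hbound : ∀ m e l, m ≤ e → ‖(-1) ^ m * q ^ e / qPoch q q l‖ ≤ C * ‖q‖ ^ m := by
    intro m e l he
    rw [div_eq_mul_inv, norm_mul, norm_mul, norm_pow, norm_neg, norm_one, one_pow, one_mul,
      mul_comm]
    exact mul_le_mul (hinv _) (norm_pow_le_pow hq he) (norm_nonneg _) hC.le
  have hterm : ∀ m, conjTerm q 0 k m =
      (-1) ^ m * q ^ ((m + 1).choose 2 + m * k) / qPoch q q (m + k + 1) := by
    intro m
    have h1 := h m
    have h2 := h (m + k + 1)
    simp only [conjTerm, add_zero]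
    field_simp
  have hsum : Summable (conjTerm q 0 k) := by
    refine summable_of_norm_le_mul_pow (norm_nonneg q) hq (C := C) fun m => ?_
    rw [hterm]
    exact hbound _ _ _ ((le_choose_two_succ m).trans (Nat.le_add_right _ _))
  rw [hsum.hasSum_iff_tendsto_nat]
  -- For `r = 0` the numerator (q;q)_m cancels and the series telescopes, with a remainder tending
  -- to 0.
  have hpartial : ∀ N, ∑ m ∈ Finset.range N, conjTerm q 0 k m = (qPoch q q k)⁻¹ -
      (-1) ^ N * q ^ ((N + 1).choose 2 + N * k) / qPoch q q (N + k) := by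
    intro N
    induction N with
    | zero => simp
    | succ N ih =>
      have hc : (N + 1 + 1).choose 2 = (N + 1).choose 2 + (N + 1) := by
        have := Nat.choose_succ_succ' (N + 1) 1
        simp only [Nat.choose_one_right, Nat.reduceAdd] at this
        omega
      rw [Finset.sum_range_succ, ih, hterm, hc, show N + 1 + k = N + k + 1 by ring, qPoch_succ]
      have h1 := h (N + k)
      have h2 := h k
      have h3 := one_sub_pow_mul_ne_zero hq hq (N + k)
      field_simp
      ring
  simp only [hpartial]
  have hlim : Filter.Tendsto
      (fun N : ℕ => (-1) ^ N * q ^ ((N + 1).choose 2 + N * k) / qPoch q q (N + k))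
      Filter.atTop (nhds 0) := by
    refine squeeze_zero_norm
      (fun N => hbound N _ _ ((le_choose_two_succ N).trans (Nat.le_add_right _ _))) ?_
    simpa using (tendsto_pow_atTop_nhds_zero_of_lt_one (norm_nonneg q) hq).const_mul C
  simpa using hlim.const_sub (qPoch q q k)⁻¹

/-- The application has `r = k`, where the sum is 1. The indices are kept apart because the
recurrence lowers `r` at the price of raising `k`. -/
theorem hasSum_conjTerm {q : ℂ} (hq : ‖q‖ < 1) (r k : ℕ) :
    HasSum (conjTerm q r k) (qPoch q q r / qPoch q q k) := by
  have h := qPoch_ne_zero hq hq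
  induction r generalizing k with
  | zero => simpa using hasSum_conjTerm_zero hq k
  | succ r ih =>
    have := (ih k).sub ((ih (k + 1)).mul_left (q ^ (r + 1) * (1 - q ^ (k + 1))))
    simp only [← conjTerm_succ hq] at this
    suffices h : qPoch q q (r + 1) / qPoch q q k = _ from h ▸ this
    rw [qPoch_succ, qPoch_succ]
    have h1 := h k
    have h3 := one_sub_pow_mul_ne_zero hq hq k
    rw [show 1 - q ^ (k + 1) = 1 - q ^ k * q by ring]
    generalize 1 - q ^ k * q = D at h3 ⊢
    field_simp
    ring

/-! ### Bilateral sums: splitting, reflection and shift -/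

/-- `1 / (q; q)_k` for an integer `k`, read as `0` for negative `k`. -/
noncomputable def invQFact (q : ℂ) (k : ℤ) : ℂ :=
  if 0 ≤ k then (qPoch q q k.toNat)⁻¹ else 0

theorem invQFact_natCast (q : ℂ) (k : ℕ) : invQFact q k = (qPoch q q k)⁻¹ := by
  simp [invQFact]

theorem invQFact_of_neg (q : ℂ) {k : ℤ} (hk : k < 0) : invQFact q k = 0 :=
  if_neg hk.not_ge

/-- The value 0 at negative indices makes this hold for all integers: at k = 0 the factor 1 - q^0
vanishes, matching 1/(q;q)_{-1} = 0. -/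
theorem one_sub_zpow_mul_invQFact {q : ℂ} (hq : ‖q‖ < 1) (k : ℤ) :
    (1 - q ^ k) * invQFact q k = invQFact q (k - 1) := by
  rcases lt_trichotomy k 0 with hk | rfl | hk
  · rw [invQFact_of_neg q hk, invQFact_of_neg q (by omega), mul_zero]
  · rw [invQFact_of_neg q (by omega : (0 : ℤ) - 1 < 0)]
    simp
  · obtain ⟨n, rfl⟩ : ∃ n : ℕ, k = (n + 1 : ℕ) := ⟨(k - 1).toNat, by omega⟩
    rw [show ((n + 1 : ℕ) : ℤ) - 1 = n by push_cast; ring, invQFact_natCast, invQFact_natCast,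
      zpow_natCast, qPoch_succ, pow_succ]
    have h1 := qPoch_ne_zero hq hq n
    have h2 := one_sub_pow_mul_ne_zero hq hq n
    generalize 1 - q ^ n * q = D at h2 ⊢
    field_simp

/-- A q-Pascal rule, from 1 - q^(u+v) = (1 - q^v) + q^v (1 - q^u). -/
theorem one_sub_zpow_mul_invQFact_mul {q : ℂ} (hq : ‖q‖ < 1) (h0 : q ≠ 0) (u v : ℤ) :
    (1 - q ^ (u + v)) * (invQFact q u * invQFact q v) =
      invQFact q u * invQFact q (v - 1) + q ^ v * (invQFact q (u - 1) * invQFact q v) := by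
  rw [← one_sub_zpow_mul_invQFact hq u, ← one_sub_zpow_mul_invQFact hq v, zpow_add₀ h0]
  ring

/-- The bilateral sum `∑_m w(m) / ((q; q)_{a - c m} (q; q)_{b + c m})`. -/
noncomputable def bilatSum (q : ℂ) (c : ℤ) (w : ℤ → ℂ) (a b : ℤ) : ℂ :=
  ∑' m : ℤ, w m * (invQFact q (a - c * m) * invQFact q (b + c * m))

theorem summable_bilatSum (q : ℂ) {c : ℤ} (hc : 0 < c) (w : ℤ → ℂ) (a b : ℤ) :
    Summable fun m : ℤ => w m * (invQFact q (a - c * m) * invQFact q (b + c * m)) := by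
  refine summable_of_hasFiniteSupport ((Set.finite_Icc (-|b|) |a|).subset fun m hm => ?_)
  by_contra h
  apply hm
  rw [Set.mem_Icc, not_and_or, not_le, not_le] at h
  rcases h with h | h
  · have hneg : b + c * m < 0 := by nlinarith [le_abs_self b, abs_nonneg b]
    simp [invQFact_of_neg q hneg]
  · have hneg : a - c * m < 0 := by nlinarith [le_abs_self a, abs_nonneg a]
    simp [invQFact_of_neg q hneg]

theorem bilatSum_split_right {q : ℂ} (hq : ‖q‖ < 1) (h0 : q ≠ 0) {c : ℤ} (hc : 0 < c) (w : ℤ → ℂ)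
    (a b : ℤ) :
    (1 - q ^ (a + b)) * bilatSum q c w a b =
      bilatSum q c w a (b - 1) + q ^ b * bilatSum q c (fun m => w m * q ^ (c * m)) (a - 1) b := by
  simp only [bilatSum]
  rw [← tsum_mul_left, ← tsum_mul_left, ← (summable_bilatSum q hc w a (b - 1)).tsum_add
    ((summable_bilatSum q hc _ (a - 1) b).mul_left _)]
  refine tsum_congr fun m => ?_
  have h := one_sub_zpow_mul_invQFact_mul hq h0 (a - c * m) (b + c * m)
  rw [show a - c * m + (b + c * m) = a + b by ring, show b + c * m - 1 = b - 1 + c * m by ring,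
    show a - c * m - 1 = a - 1 - c * m by ring, zpow_add₀ h0 b] at h
  linear_combination w m * h

theorem bilatSum_neg (q : ℂ) (c : ℤ) (w : ℤ → ℂ) (a b : ℤ) :
    bilatSum q c w a b = bilatSum q c (fun m => w (-m)) b a := by
  simp only [bilatSum]
  rw [← (Equiv.neg ℤ).tsum_eq]
  refine tsum_congr fun m => ?_
  simp only [Equiv.neg_apply]
  rw [show a - c * -m = a + c * m by ring, show b + c * -m = b - c * m by ring,
    mul_comm (invQFact q (a + c * m))]

theorem bilatSum_split_left {q : ℂ} (hq : ‖q‖ < 1) (h0 : q ≠ 0) {c : ℤ} (hc : 0 < c) (w : ℤ → ℂ)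
    (a b : ℤ) :
    (1 - q ^ (a + b)) * bilatSum q c w a b =
      bilatSum q c w (a - 1) b + q ^ a * bilatSum q c (fun m => w m * q ^ (-(c * m))) a (b - 1) := by
  rw [bilatSum_neg q c w a, bilatSum_neg q c w (a - 1), bilatSum_neg q c _ a (b - 1), add_comm a b,
    bilatSum_split_right hq h0 hc]
  simp

theorem bilatSum_shift (q : ℂ) (c : ℤ) (w : ℤ → ℂ) (a b : ℤ) :
    bilatSum q c w a b = bilatSum q c (fun m => w (m - 1)) (a + c) (b - c) := by
  simp only [bilatSum]
  rw [← (Equiv.subRight (1 : ℤ)).tsum_eq]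
  refine tsum_congr fun m => ?_
  simp only [Equiv.subRight_apply]
  rw [show a - c * (m - 1) = a + c - c * m by ring, show b + c * (m - 1) = b - c + c * m by ring]

theorem bilatSum_const_mul (q : ℂ) (c : ℤ) (w : ℤ → ℂ) (k : ℂ) (a b : ℤ) :
    bilatSum q c (fun m => k * w m) a b = k * bilatSum q c w a b := by
  simp only [bilatSum, mul_assoc, tsum_mul_left]

/-- The substitution m ↦ -m-1 swaps the two denominators when b = a + c, so the sum equals its own
negative. -/
theorem bilatSum_eq_zero (q : ℂ) (c : ℤ) (w : ℤ → ℂ) (a b : ℤ) (hab : b = a + c)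
    (hw : ∀ m, w (-m - 1) = -w m) : bilatSum q c w a b = 0 := by
  have h : bilatSum q c w a b = -1 * bilatSum q c w a b := by
    conv_lhs => rw [bilatSum_shift, bilatSum_neg]
    rw [← bilatSum_const_mul, hab, add_sub_cancel_right]
    simp only [hw, neg_one_mul]
  linear_combination h / 2

theorem bilatSum_zero_zero (q : ℂ) {c : ℤ} (hc : 0 < c) (w : ℤ → ℂ) :
    bilatSum q c w 0 0 = w 0 := by
  rw [bilatSum, tsum_eq_single 0]
  · have := invQFact_natCast q 0
    simp only [Nat.cast_zero] at this
    simp [this]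
  · intro m hm
    rcases lt_or_gt_of_ne hm with h | h
    · rw [invQFact_of_neg q (k := 0 + c * m) (by nlinarith), mul_zero, mul_zero]
    · rw [invQFact_of_neg q (k := 0 - c * m) (by nlinarith), zero_mul, mul_zero]

/-! ### Symmetries of the theta weight -/

/-- The weight `(-1)^m q^(3 m² + k m)`. -/
noncomputable def thetaWeight (q : ℂ) (k m : ℤ) : ℂ := (-1) ^ m * q ^ (3 * m ^ 2 + k * m)

theorem thetaWeight_zero_right (q : ℂ) (k : ℤ) : thetaWeight q k 0 = 1 := by
  simp [thetaWeight]

theorem thetaWeight_neg (q : ℂ) (k m : ℤ) : thetaWeight q k (-m) = thetaWeight q (-k) m := by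
  simp only [thetaWeight, neg_sq, mul_neg, neg_mul]
  rw [zpow_neg, ← inv_zpow, inv_neg_one]

theorem thetaWeight_mul_zpow {q : ℂ} (h0 : q ≠ 0) (k l m : ℤ) :
    thetaWeight q k m * q ^ (l * m) = thetaWeight q (k + l) m := by
  rw [thetaWeight, thetaWeight, mul_assoc, ← zpow_add₀ h0]
  ring_nf

theorem thetaWeight_sub_one {q : ℂ} (h0 : q ≠ 0) (k m : ℤ) :
    thetaWeight q k (m - 1) = -q ^ (3 - k) * thetaWeight q (k - 6) m := by
  rw [thetaWeight, thetaWeight, zpow_sub_one₀ (by norm_num), inv_neg_one,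
    show 3 * (m - 1) ^ 2 + k * (m - 1) = (3 - k) + (3 * m ^ 2 + (k - 6) * m) by ring,
    zpow_add₀ h0]
  ring

/-- The exponent 3m(m+1) is invariant under m ↦ -m-1 while the sign flips. -/
theorem thetaWeight_three_neg_sub_one {q : ℂ} (h0 : q ≠ 0) (m : ℤ) :
    thetaWeight q 3 (-m - 1) = -thetaWeight q 3 m := by
  rw [thetaWeight_sub_one h0, thetaWeight_neg]
  norm_num

theorem norm_thetaWeight_le_one {q : ℂ} (hq : ‖q‖ < 1) {k m : ℤ} (h : 0 ≤ 3 * m ^ 2 + k * m) :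
    ‖thetaWeight q k m‖ ≤ 1 := by
  obtain ⟨n, hn⟩ := Int.eq_ofNat_of_zero_le h
  rw [thetaWeight, hn, norm_mul, norm_zpow, norm_neg, norm_one, one_zpow, one_mul]
  simpa using pow_le_one₀ (norm_nonneg q) hq.le

theorem thetaWeight_mul_zpow_funext {q : ℂ} (h0 : q ≠ 0) {k l k' : ℤ} (h : k + l = k') :
    (fun m => thetaWeight q k m * q ^ (l * m)) = thetaWeight q k' :=
  funext fun m => by rw [thetaWeight_mul_zpow h0, h]

theorem bilatSum_thetaWeight_neg (q s : ℂ) (c k a b : ℤ) :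
    bilatSum q c (thetaWeight s (-k)) a b = bilatSum q c (thetaWeight s k) b a := by
  rw [bilatSum_neg]
  congr 1
  funext m
  rw [thetaWeight_neg, neg_neg]

theorem bilatSum_thetaWeight_shift (q : ℂ) {s : ℂ} (h0 : s ≠ 0) (c k a b : ℤ) :
    bilatSum q c (thetaWeight s k) a b =
      -s ^ (3 - k) * bilatSum q c (thetaWeight s (k - 6)) (a + c) (b - c) := by
  rw [bilatSum_shift, ← bilatSum_const_mul]
  simp only [thetaWeight_sub_one h0]

/-! ### Bailey pairs for φ_D and ψ_D (step 2, base q) -/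

section QuadraticBase

variable {q : ℂ}

theorem bilatSum_two_three (h0 : q ≠ 0) (n : ℤ) :
    bilatSum q 2 (thetaWeight q 3) (n - 1) (n + 1) = 0 :=
  bilatSum_eq_zero q 2 _ _ _ (by ring) (thetaWeight_three_neg_sub_one h0)

/-- The second piece of the splitting has weight k = 3 at (n-1, n+1), where antisymmetry kills it.
-/
theorem one_sub_mul_bilatSum_two_odd (hq : ‖q‖ < 1) (h0 : q ≠ 0) (n : ℤ) :
    (1 - q ^ (n + (n + 1))) * bilatSum q 2 (thetaWeight q 1) n (n + 1) =
      bilatSum q 2 (thetaWeight q 1) n n := by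
  rw [bilatSum_split_right hq h0 two_pos,
    thetaWeight_mul_zpow_funext h0 (show (1 : ℤ) + 2 = 3 by norm_num), bilatSum_two_three h0,
    mul_zero, add_zero, add_sub_cancel_right]

theorem one_sub_mul_bilatSum_two_three (hq : ‖q‖ < 1) (h0 : q ≠ 0) (n : ℤ) :
    (1 - q ^ (n + (n + 1))) * bilatSum q 2 (thetaWeight q 3) n (n + 1) =
      q ^ n * bilatSum q 2 (thetaWeight q 1) n n := by
  rw [bilatSum_split_left hq h0 two_pos, bilatSum_two_three h0, zero_add, add_sub_cancel_right]
  simp only [← neg_mul]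
  rw [thetaWeight_mul_zpow_funext h0 (show (3 : ℤ) + -2 = 1 by norm_num)]

theorem one_sub_mul_bilatSum_two_even (hq : ‖q‖ < 1) (h0 : q ≠ 0) (n : ℤ) :
    (1 - q ^ (n + 1 + (n + 1))) * bilatSum q 2 (thetaWeight q 1) (n + 1) (n + 1) =
      (1 + q ^ (n + 1)) * bilatSum q 2 (thetaWeight q 1) n (n + 1) := by
  rw [bilatSum_split_left hq h0 two_pos, add_sub_cancel_right]
  simp only [← neg_mul]
  rw [thetaWeight_mul_zpow_funext h0 (show (1 : ℤ) + -2 = -1 by norm_num),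
    bilatSum_thetaWeight_neg]
  ring

theorem one_sub_pow_ne_zero (hq : ‖q‖ < 1) (n : ℕ) : 1 - q ^ (n + 1) ≠ 0 := by
  simpa [pow_succ] using one_sub_pow_mul_ne_zero hq hq n

theorem one_add_pow_ne_zero {q : ℂ} (hq : ‖q‖ < 1) (n : ℕ) : 1 + q ^ (n + 1) ≠ 0 := by
  have := one_sub_pow_mul_ne_zero (x := -q) (by rwa [norm_neg]) hq n
  simpa [pow_succ] using this

theorem bilatSum_two_even_eq (hq : ‖q‖ < 1) (h0 : q ≠ 0) (n : ℕ) :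
    qPoch q q n * bilatSum q 2 (thetaWeight q 1) n n = (qPoch q (q ^ 2) n)⁻¹ := by
  induction n with
  | zero => simp [bilatSum_zero_zero, thetaWeight_zero_right]
  | succ n ih =>
    have h1 := one_sub_mul_bilatSum_two_odd hq h0 n
    have h2 := one_sub_mul_bilatSum_two_even hq h0 n
    have e1 : (n : ℤ) + (n + 1) = (2 * n + 1 : ℕ) := by push_cast; ring
    have e2 : (n : ℤ) + 1 + (n + 1) = (2 * (n + 1) : ℕ) := by push_cast; ring
    have e3 : (n : ℤ) + 1 = (n + 1 : ℕ) := by push_cast; ring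
    rw [e1, zpow_natCast] at h1
    rw [e2, zpow_natCast] at h2
    rw [e3] at h1 h2
    rw [zpow_natCast, mul_comm 2, pow_mul] at h2
    rw [qPoch_succ, qPoch_succ, mul_inv, ← ih, ← h1, ← pow_succ, ← pow_mul, ← pow_succ]
    have h3 := one_sub_pow_ne_zero hq n
    have h4 := one_sub_pow_ne_zero hq (2 * n)
    have h5 := one_add_pow_ne_zero hq n
    generalize q ^ (2 * n + 1) = z at *
    generalize q ^ (n + 1) = y at *
    -- With y = q^(n+1), cancel 1 + y from 1 - y² = (1-y)(1+y); the remaining 1 - y is the new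
    -- factor of (q;q)_{n+1}.
    have h6 : bilatSum q 2 (thetaWeight q 1) (n + 1 : ℕ) (n + 1 : ℕ) * (1 - y) =
        bilatSum q 2 (thetaWeight q 1) n (n + 1 : ℕ) :=
      mul_left_cancel₀ h5 (by linear_combination h2)
    rw [← h6]
    field_simp

theorem bilatSum_two_odd_eq (hq : ‖q‖ < 1) (h0 : q ≠ 0) (n : ℕ) :
    qPoch q q n * bilatSum q 2 (thetaWeight q 1) n (n + 1) = (qPoch q (q ^ 2) (n + 1))⁻¹ := by
  have h1 := one_sub_mul_bilatSum_two_odd hq h0 n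
  have e1 : (n : ℤ) + (n + 1) = (2 * n + 1 : ℕ) := by push_cast; ring
  rw [e1, zpow_natCast] at h1
  have h4 := one_sub_pow_ne_zero hq (2 * n)
  rw [qPoch_succ, mul_inv, ← bilatSum_two_even_eq hq h0, ← h1, ← pow_mul, ← pow_succ]
  field_simp

theorem bilatSum_two_three_eq (hq : ‖q‖ < 1) (h0 : q ≠ 0) (n : ℕ) :
    qPoch q q n * bilatSum q 2 (thetaWeight q 3) n (n + 1) =
      q ^ n * (qPoch q (q ^ 2) (n + 1))⁻¹ := by
  have h1 := one_sub_mul_bilatSum_two_odd hq h0 n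
  have h2 := one_sub_mul_bilatSum_two_three hq h0 n
  have e1 : (n : ℤ) + (n + 1) = (2 * n + 1 : ℕ) := by push_cast; ring
  rw [e1, zpow_natCast] at h1 h2
  rw [← bilatSum_two_odd_eq hq h0]
  refine mul_left_cancel₀ (one_sub_pow_ne_zero hq (2 * n)) ?_
  rw [← h1, zpow_natCast] at h2
  linear_combination qPoch q q n * h2

end QuadraticBase

/-! ### Bailey pairs for X_D and χ_D (step 1, base s⁴) -/

section QuarticBase

variable {s : ℂ}

theorem norm_pow_four_lt_one (hs : ‖s‖ < 1) : ‖s ^ 4‖ < 1 := by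
  rw [norm_pow]
  exact pow_lt_one₀ (norm_nonneg _) hs four_ne_zero

theorem pow_four_zpow (s : ℂ) (k : ℤ) : (s ^ 4) ^ k = s ^ (4 * k) := by
  rw [zpow_mul]
  norm_cast

/-- Splitting produces k = 5 at (n-1, n+1); a shift followed by a reflection brings it back to k = 1
at (n, n). -/
theorem one_sub_mul_bilatSum_one_odd (hs : ‖s‖ < 1) (h0 : s ≠ 0) (n : ℤ) :
    (1 - s ^ (4 * (n + (n + 1)))) * bilatSum (s ^ 4) 1 (thetaWeight s 1) n (n + 1) =
      (1 - s ^ (4 * n + 2)) * bilatSum (s ^ 4) 1 (thetaWeight s 1) n n := by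
  rw [← pow_four_zpow, bilatSum_split_right (norm_pow_four_lt_one hs) (pow_ne_zero 4 h0) one_pos,
    add_sub_cancel_right]
  simp only [pow_four_zpow, one_mul]
  rw [thetaWeight_mul_zpow_funext h0 (show (1 : ℤ) + 4 = 5 by norm_num),
    bilatSum_thetaWeight_shift _ h0 1 5, show (5 : ℤ) - 6 = -1 by norm_num, bilatSum_thetaWeight_neg,
    sub_add_cancel, add_sub_cancel_right,
    show 4 * n + 2 = 4 * (n + 1) + (3 - 5) by ring, zpow_add₀ h0]
  ring

theorem one_sub_mul_bilatSum_one_even (hs : ‖s‖ < 1) (h0 : s ≠ 0) (n : ℤ) :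
    (1 - s ^ (4 * (n + 1 + (n + 1)))) * bilatSum (s ^ 4) 1 (thetaWeight s 1) (n + 1) (n + 1) =
      bilatSum (s ^ 4) 1 (thetaWeight s 1) n (n + 1) := by
  rw [← pow_four_zpow, bilatSum_split_left (norm_pow_four_lt_one hs) (pow_ne_zero 4 h0) one_pos,
    add_sub_cancel_right]
  simp only [pow_four_zpow, one_mul]
  simp only [← neg_mul_comm]
  rw [thetaWeight_mul_zpow_funext h0 (show (1 : ℤ) + -4 = -3 by norm_num),
    bilatSum_thetaWeight_neg, bilatSum_eq_zero _ _ _ _ _ rfl (thetaWeight_three_neg_sub_one h0),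
    mul_zero, add_zero]

/-- By reflection, k = 1 and k = -1 agree at (n+1, n+1). Splitting each version and comparing gives
the relation. -/
theorem bilatSum_one_odd_neg (hs : ‖s‖ < 1) (h0 : s ≠ 0) (n : ℤ) :
    bilatSum (s ^ 4) 1 (thetaWeight s (-1)) n (n + 1) =
      (1 + s ^ (4 * n + 2)) * bilatSum (s ^ 4) 1 (thetaWeight s 1) n (n + 1) := by
  have h1 := one_sub_mul_bilatSum_one_even hs h0 n
  rw [← bilatSum_thetaWeight_neg, ← pow_four_zpow,
    bilatSum_split_left (norm_pow_four_lt_one hs) (pow_ne_zero 4 h0) one_pos,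
    add_sub_cancel_right] at h1
  simp only [pow_four_zpow, one_mul] at h1
  simp only [← neg_mul_comm] at h1
  rw [thetaWeight_mul_zpow_funext h0 (show (-1 : ℤ) + -4 = -5 by norm_num),
    bilatSum_thetaWeight_neg _ _ _ 5, bilatSum_thetaWeight_shift _ h0 1 5, show (5 : ℤ) - 6 = -1 by norm_num,
    bilatSum_thetaWeight_neg, add_sub_cancel_right] at h1
  rw [show 4 * n + 2 = 4 * (n + 1) + (3 - 5) by ring, zpow_add₀ h0,
    bilatSum_thetaWeight_neg]
  rw [bilatSum_thetaWeight_neg] at h1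
  linear_combination h1

theorem bilatSum_one_eq (hs : ‖s‖ < 1) (h0 : s ≠ 0) (n : ℕ) :
    qPoch (s ^ 4) (s ^ 4) n * bilatSum (s ^ 4) 1 (thetaWeight s 1) n n =
        (qPoch (-s ^ 2) (s ^ 2) (2 * n))⁻¹ ∧
      qPoch (s ^ 4) (s ^ 4) n * bilatSum (s ^ 4) 1 (thetaWeight s 1) n (n + 1) =
        (qPoch (-s ^ 2) (s ^ 2) (2 * n + 1))⁻¹ := by
  have hq := norm_sq_lt_one hs
  have hodd : ∀ n : ℕ, bilatSum (s ^ 4) 1 (thetaWeight s 1) n (n + 1) =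
      bilatSum (s ^ 4) 1 (thetaWeight s 1) n n * (1 - (s ^ 2) ^ (2 * n) * -s ^ 2)⁻¹ := by
    intro n
    have h1 := one_sub_mul_bilatSum_one_odd hs h0 n
    have e1 : 4 * ((n : ℤ) + (n + 1)) = (4 * (n + (n + 1)) : ℕ) := by push_cast; ring
    have e2 : 4 * (n : ℤ) + 2 = (4 * n + 2 : ℕ) := by push_cast; ring
    rw [e1, e2, zpow_natCast, zpow_natCast,
      show s ^ (4 * (n + (n + 1))) = (s ^ (4 * n + 2)) ^ 2 by ring] at h1
    have h2 := one_sub_pow_ne_zero hq (2 * n)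
    have h3 := one_add_pow_ne_zero hq (2 * n)
    have h4 : (s ^ 2) ^ (2 * n + 1) = s ^ (4 * n + 2) := by ring
    rw [h4] at h2 h3
    rw [show 1 - (s ^ 2) ^ (2 * n) * -s ^ 2 = 1 + s ^ (4 * n + 2) by ring, eq_mul_inv_iff_mul_eq₀ h3]
    refine mul_left_cancel₀ h2 ?_
    linear_combination h1
  have hstep : ∀ n : ℕ, qPoch (s ^ 4) (s ^ 4) n * bilatSum (s ^ 4) 1 (thetaWeight s 1) n n =
        (qPoch (-s ^ 2) (s ^ 2) (2 * n))⁻¹ →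
      qPoch (s ^ 4) (s ^ 4) n * bilatSum (s ^ 4) 1 (thetaWeight s 1) n (n + 1) =
        (qPoch (-s ^ 2) (s ^ 2) (2 * n + 1))⁻¹ := by
    intro n h
    rw [qPoch_succ, mul_inv, ← h, hodd, mul_assoc]
  have heven : ∀ n : ℕ, qPoch (s ^ 4) (s ^ 4) n * bilatSum (s ^ 4) 1 (thetaWeight s 1) n n =
        (qPoch (-s ^ 2) (s ^ 2) (2 * n))⁻¹ := by
    intro n
    induction n with
    | zero => simp [bilatSum_zero_zero, thetaWeight_zero_right]
    | succ n ih =>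
      have h1 := one_sub_mul_bilatSum_one_even hs h0 n
      have e1 : 4 * ((n : ℤ) + 1 + (n + 1)) = (4 * (n + 1 + (n + 1)) : ℕ) := by push_cast; ring
      rw [e1, zpow_natCast,
        show s ^ (4 * (n + 1 + (n + 1))) = (s ^ (4 * (n + 1))) ^ 2 by ring] at h1
      have h2 := one_sub_pow_ne_zero hq (2 * n + 1)
      have h3 := one_add_pow_ne_zero hq (2 * n + 1)
      have h4 : (s ^ 2) ^ (2 * n + 1 + 1) = s ^ (4 * (n + 1)) := by ring
      rw [h4] at h2 h3
      rw [show 2 * (n + 1) = 2 * n + 1 + 1 by ring, qPoch_succ _ _ (2 * n + 1), mul_inv,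
        ← hstep n ih, qPoch_succ, ← h1,
        show 1 - (s ^ 2) ^ (2 * n + 1) * -s ^ 2 = 1 + s ^ (4 * (n + 1)) by ring,
        eq_mul_inv_iff_mul_eq₀ h3]
      push_cast
      ring
  exact ⟨heven n, hstep n (heven n)⟩

theorem bilatSum_one_odd_neg_eq (hs : ‖s‖ < 1) (h0 : s ≠ 0) (n : ℕ) :
    qPoch (s ^ 4) (s ^ 4) n * bilatSum (s ^ 4) 1 (thetaWeight s (-1)) n (n + 1) =
      (qPoch (-s ^ 2) (s ^ 2) (2 * n))⁻¹ := by
  have h3 := one_add_pow_ne_zero (norm_sq_lt_one hs) (2 * n)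
  have e2 : 4 * (n : ℤ) + 2 = (4 * n + 2 : ℕ) := by push_cast; ring
  have h4 : (s ^ 2) ^ (2 * n + 1) = s ^ (4 * n + 2) := by ring
  rw [h4] at h3
  rw [bilatSum_one_odd_neg hs h0, e2, zpow_natCast, mul_left_comm, (bilatSum_one_eq hs h0 n).2,
    qPoch_succ, show 1 - (s ^ 2) ^ (2 * n) * -s ^ 2 = 1 + s ^ (4 * n + 2) by ring, mul_inv]
  field_simp

end QuarticBase

/-! ### The Bailey transform -/

section BaileyTransform

variable {q : ℂ}

/-- Summand of the Bailey transform with `δ_n = (-1)^n q^(n (n + 1) / 2) (q; q)_n`. -/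
noncomputable def baileyTerm (q : ℂ) (n ρ : ℕ) : ℂ :=
  (-1) ^ n * q ^ ((n + 1).choose 2) * qPoch q q n * (invQFact q (n - ρ) * invQFact q (n + 1 + ρ))

theorem baileyTerm_of_lt {n ρ : ℕ} (h : n < ρ) : baileyTerm q n ρ = 0 := by
  rw [baileyTerm, invQFact_of_neg q (by omega : (n : ℤ) - ρ < 0), zero_mul, mul_zero]

theorem choose_two_add_succ (m r : ℕ) :
    (m + r + 1).choose 2 = (m + 1).choose 2 + m * r + (r + 1).choose 2 := by
  have h1 := choose_two_succ_mul_two (m + r)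
  have h2 := choose_two_succ_mul_two m
  have h3 := choose_two_succ_mul_two r
  nlinarith

theorem baileyTerm_add (m ρ : ℕ) :
    baileyTerm q (m + ρ) ρ = (-1) ^ ρ * q ^ ((ρ + 1).choose 2) * conjTerm q ρ ρ m := by
  rw [baileyTerm, conjTerm, show ((m + ρ : ℕ) : ℤ) - ρ = m by push_cast; ring,
    show ((m + ρ : ℕ) : ℤ) + 1 + ρ = (m + ρ + ρ + 1 : ℕ) by push_cast; ring, invQFact_natCast,
    invQFact_natCast, choose_two_add_succ]
  ring

theorem hasSum_baileyTerm (hq : ‖q‖ < 1) (ρ : ℕ) :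
    HasSum (fun n => baileyTerm q n ρ) ((-1) ^ ρ * q ^ ((ρ + 1).choose 2)) := by
  rw [← (add_left_injective ρ).hasSum_iff]
  · have h := (hasSum_conjTerm hq ρ ρ).mul_left ((-1) ^ ρ * q ^ ((ρ + 1).choose 2))
    rw [div_self (qPoch_ne_zero hq hq ρ), mul_one] at h
    exact h.congr_fun fun m => baileyTerm_add m ρ
  · intro n hn
    refine baileyTerm_of_lt ?_
    by_contra h
    exact hn ⟨n - ρ, by simp only; omega⟩

theorem norm_invQFact_le {C : ℝ} (hC : ∀ n, ‖(qPoch q q n)⁻¹‖ ≤ C) (k : ℤ) :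
    ‖invQFact q k‖ ≤ C := by
  rw [invQFact]
  split_ifs
  · exact hC _
  · simpa using (norm_nonneg _).trans (hC 0)

theorem exists_norm_baileyTerm_le (hq : ‖q‖ < 1) :
    ∃ C : ℝ, ∃ s : ℝ, 0 ≤ s ∧ s < 1 ∧ ∀ n ρ r : ℕ, r ≤ ρ →
      ‖baileyTerm q n ρ‖ ≤ C * (s ^ n * s ^ r) := by
  obtain ⟨C, hC, h⟩ := exists_norm_inv_qPoch_le hq hq
  set D := Real.exp (1 - ‖q‖)⁻¹ with hD
  have hs : √‖q‖ < 1 := by rw [Real.sqrt_lt' one_pos]; simpa using hq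
  refine ⟨D * (C * C), √‖q‖, Real.sqrt_nonneg _, hs, fun n ρ r hr => ?_⟩
  rcases lt_or_ge n ρ with hn | hn
  · rw [baileyTerm_of_lt hn, norm_zero]
    positivity
  -- Since r ≤ ρ ≤ n, half of the decay |q|^n can be spent on r, giving summability in both indices.
  · have h1 : ‖q ^ ((n + 1).choose 2)‖ ≤ √‖q‖ ^ n * √‖q‖ ^ r := by
      refine (norm_pow_le_pow hq (le_choose_two_succ n)).trans ?_
      rw [← pow_add]
      conv_lhs => rw [← Real.sq_sqrt (norm_nonneg q), ← pow_mul]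
      exact pow_le_pow_of_le_one (Real.sqrt_nonneg _) hs.le (by omega)
    rw [baileyTerm, norm_mul, norm_mul, norm_mul, norm_mul, norm_pow, norm_neg, norm_one, one_pow,
      one_mul]
    calc _ ≤ (√‖q‖ ^ n * √‖q‖ ^ r) * D * (C * C) := by
          gcongr
          · exact norm_qPoch_le hq hq n
          · exact norm_invQFact_le h _
          · exact norm_invQFact_le h _
      _ = _ := by ring

/-- One half of the Bailey transform. -/
theorem hasSum_tsum_mul_baileyTerm (hq : ‖q‖ < 1) {a : ℕ → ℂ} (ha : ∀ r, ‖a r‖ ≤ 1) {ρ : ℕ → ℕ}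
    (hρ : ∀ r, r ≤ ρ r) :
    HasSum (fun n => ∑' r, a r * baileyTerm q n (ρ r))
      (∑' r, a r * ((-1) ^ ρ r * q ^ ((ρ r + 1).choose 2))) := by
  obtain ⟨C, s, hs0, hs1, hC⟩ := exists_norm_baileyTerm_le hq
  have hgeo := summable_geometric_of_lt_one hs0 hs1
  have hsum : Summable (Function.uncurry fun n r => a r * baileyTerm q n (ρ r)) := by
    refine Summable.of_norm_bounded ((hgeo.mul_of_nonneg hgeo (fun n => pow_nonneg hs0 n)
      fun n => pow_nonneg hs0 n).mul_left C) ?_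
    rintro ⟨n, r⟩
    rw [Function.uncurry_apply_pair, norm_mul]
    calc _ ≤ 1 * (C * (s ^ n * s ^ r)) :=
          mul_le_mul (ha r) (hC n _ r (hρ r)) (norm_nonneg _) zero_le_one
      _ = _ := one_mul _
  have h := hsum.tsum_comm
  simp only [tsum_mul_left, (hasSum_baileyTerm hq _).tsum_eq] at h
  rw [h]
  exact (hsum.prod).hasSum

theorem tsum_int_eq_add {f : ℤ → ℂ} (hf : Summable f) :
    ∑' m, f m = ∑' n : ℕ, f n + ∑' n : ℕ, f (-(n + 1)) :=
  tsum_of_nat_of_neg_add_one (hf.comp_injective Nat.cast_injective)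
    (hf.comp_injective (i := fun r : ℕ => -((r : ℤ) + 1)) fun x y hxy => by simpa using hxy)

/-- The step is c = d + 1. For m = -(r+1) the two denominators trade places, so negative m
contribute with ρ = c(r+1) - 1 = c r + d. -/
theorem hasSum_mul_bilatSum (hq : ‖q‖ < 1) (d : ℕ) {w : ℤ → ℂ} (hw : ∀ m, ‖w m‖ ≤ 1) :
    HasSum (fun n : ℕ => (-1) ^ n * q ^ ((n + 1).choose 2) *
        (qPoch q q n * bilatSum q (d + 1) w n (n + 1)))
      (∑' r : ℕ, w r * ((-1) ^ ((d + 1) * r) * q ^ (((d + 1) * r + 1).choose 2)) +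
        ∑' r : ℕ, w (-(r + 1)) *
          ((-1) ^ ((d + 1) * r + d) * q ^ (((d + 1) * r + d + 1).choose 2))) := by
  have h := (hasSum_tsum_mul_baileyTerm hq (a := fun r => w r) (fun r => hw r)
    (ρ := fun r => (d + 1) * r) fun r => by nlinarith).add
    (hasSum_tsum_mul_baileyTerm hq (a := fun r => w (-(r + 1))) (fun r => hw _)
    (ρ := fun r => (d + 1) * r + d) fun r => by nlinarith)
  refine h.congr_fun fun n => ?_
  have hs := summable_bilatSum q (c := d + 1) (by positivity) w n (n + 1)
  rw [bilatSum, tsum_int_eq_add hs, mul_add, mul_add]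
  simp only [← tsum_mul_left]
  refine congrArg₂ (· + ·) (tsum_congr fun r => ?_) (tsum_congr fun r => ?_)
  · simp only [baileyTerm]
    push_cast
    ring
  · simp only [baileyTerm]
    rw [show (n : ℤ) - (d + 1) * -(r + 1) = n + 1 + ((d + 1) * r + d : ℕ) by push_cast; ring,
      show (n : ℤ) + 1 + (d + 1) * -(r + 1) = n - ((d + 1) * r + d : ℕ) by push_cast; ring]
    ring

end BaileyTransform

/-! ### Partial theta expansions of the four duals -/

/-- The partial theta series `∑_{n ≥ 0} ε^n q^(5 n² + A n + B)`. -/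
noncomputable def partialTheta (ε : ℂ) (A B : ℕ) (q : ℂ) : ℂ :=
  ∑' n : ℕ, ε ^ n * q ^ (5 * n ^ 2 + A * n + B)

theorem thetaWeight_natCast_mul_pow {q : ℂ} (h0 : q ≠ 0) {k : ℤ} {r b e : ℕ}
    (he : (e : ℤ) = 3 * r ^ 2 + k * r + b) : thetaWeight q k r * q ^ b = (-1) ^ r * q ^ e := by
  rw [thetaWeight, mul_assoc, ← zpow_natCast q b, ← zpow_add₀ h0, ← he, zpow_natCast,
    zpow_natCast]

theorem thetaWeight_neg_natCast_mul_pow {q : ℂ} (h0 : q ≠ 0) {k : ℤ} {r b e : ℕ}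
    (he : (e : ℤ) = 3 * (r + 1) ^ 2 - k * (r + 1) + b) :
    thetaWeight q k (-(r + 1)) * q ^ b = -((-1) ^ r * q ^ e) := by
  have h := thetaWeight_natCast_mul_pow h0 (k := -k) (r := r + 1) (b := b) (e := e)
    (by push_cast; linarith)
  rw [thetaWeight_neg]
  push_cast at h
  rw [h]
  ring

theorem norm_thetaWeight_le_one_of_abs_le {q : ℂ} (hq : ‖q‖ < 1) {k : ℤ} (hk : |k| ≤ 3) (m : ℤ) :
    ‖thetaWeight q k m‖ ≤ 1 := by
  refine norm_thetaWeight_le_one hq ?_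
  obtain ⟨h1, h2⟩ := abs_le.mp hk
  rcases lt_trichotomy m 0 with h | rfl | h
  · nlinarith
  · simp
  · nlinarith

theorem choose_two_cast (n : ℕ) : (((n + 1).choose 2 : ℕ) : ℤ) * 2 = n * (n + 1) := by
  exact_mod_cast choose_two_succ_mul_two n

theorem psiD_eq {q : ℂ} (hq : ‖q‖ < 1) (h0 : q ≠ 0) :
    psiD q = -(partialTheta (-1) 2 0 q + partialTheta (-1) 8 3 q) := by
  have h := (hasSum_mul_bilatSum hq 1
    (norm_thetaWeight_le_one_of_abs_le (k := 1) hq (by norm_num))).neg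
  have h1 : HasSum (psiDTerm q) _ := h.congr_fun fun n => by
    rw [psiDTerm, show (((1 : ℕ) : ℤ) + 1) = 2 by norm_num, bilatSum_two_odd_eq hq h0]
    ring
  rw [psiD, h1.tsum_eq, partialTheta, partialTheta]
  congr 2
  · refine tsum_congr fun r => ?_
    rw [mul_left_comm, thetaWeight_natCast_mul_pow h0 (e := 5 * r ^ 2 + 2 * r + 0), pow_mul]
    · norm_num
    · have := choose_two_cast ((1 + 1) * r)
      push_cast at this ⊢
      linarith
  · refine tsum_congr fun r => ?_
    rw [mul_left_comm, thetaWeight_neg_natCast_mul_pow h0 (e := 5 * r ^ 2 + 8 * r + 3), pow_succ,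
      pow_mul]
    · norm_num
    · have := choose_two_cast ((1 + 1) * r + 1)
      push_cast at this ⊢
      linarith

theorem phiD_eq {q : ℂ} (hq : ‖q‖ < 1) (h0 : q ≠ 0) :
    phiD q = -(partialTheta (-1) 4 1 q + partialTheta (-1) 6 2 q) := by
  have h := (hasSum_mul_bilatSum hq 1
    (norm_thetaWeight_le_one_of_abs_le (k := 3) hq (by norm_num))).mul_left (-q)
  have h1 : HasSum (phiDTerm q) _ := h.congr_fun fun n => by
    -- The exponent exceeds that of the transform by n + 1: the k = 3 pair supplies q^n and the
    -- prefactor -q the rest.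
    have hc := choose_two_add_succ n 1
    rw [phiDTerm, show (((1 : ℕ) : ℤ) + 1) = 2 by norm_num, bilatSum_two_three_eq hq h0,
      show n + 2 = n + 1 + 1 by ring, hc]
    norm_num
    ring
  rw [phiD, h1.tsum_eq, partialTheta, partialTheta, neg_mul, mul_add, ← tsum_mul_left,
    ← tsum_mul_left]
  congr 2
  · refine tsum_congr fun r => ?_
    rw [mul_left_comm (thetaWeight q 3 r),
      thetaWeight_natCast_mul_pow h0 (e := 5 * r ^ 2 + 4 * r), pow_mul]
    · norm_num
      ring
    · have := choose_two_cast ((1 + 1) * r)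
      push_cast at this ⊢
      linarith
  · refine tsum_congr fun r => ?_
    rw [mul_left_comm (thetaWeight q 3 _),
      thetaWeight_neg_natCast_mul_pow h0 (e := 5 * r ^ 2 + 6 * r + 1), pow_succ, pow_mul]
    · norm_num
      ring
    · have := choose_two_cast ((1 + 1) * r + 1)
      push_cast at this ⊢
      linarith

/-- The signs of the weight and of the conjugate pair cancel, whence ε = 1; the exponents add to 3r²
+ kr + 2r(r+1). -/
theorem tsum_thetaWeight_natCast {s : ℂ} (h0 : s ≠ 0) (k : ℤ) (A : ℕ) (hA : (A : ℤ) = k + 2) :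
    ∑' r : ℕ, thetaWeight s k r *
        ((-1) ^ ((0 + 1) * r) * (s ^ 4) ^ (((0 + 1) * r + 1).choose 2)) =
      partialTheta 1 A 0 s := by
  refine tsum_congr fun r => ?_
  rw [mul_left_comm, ← pow_mul, thetaWeight_natCast_mul_pow h0 (e := 5 * r ^ 2 + A * r + 0),
    ← mul_assoc, ← pow_add, Even.neg_one_pow ⟨r, by ring⟩, one_pow]
  have := choose_two_cast ((0 + 1) * r)
  push_cast at this ⊢
  rw [hA]
  linarith

theorem tsum_thetaWeight_neg_natCast {s : ℂ} (h0 : s ≠ 0) (k : ℤ) (A B : ℕ)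
    (hA : (A : ℤ) = 8 - k) (hB : (B : ℤ) = 3 - k) :
    ∑' r : ℕ, thetaWeight s k (-(r + 1)) *
        ((-1) ^ ((0 + 1) * r + 0) * (s ^ 4) ^ (((0 + 1) * r + 0 + 1).choose 2)) =
      -partialTheta 1 A B s := by
  rw [partialTheta, ← tsum_neg]
  refine tsum_congr fun r => ?_
  rw [mul_left_comm, ← pow_mul, thetaWeight_neg_natCast_mul_pow h0 (e := 5 * r ^ 2 + A * r + B),
    mul_neg, ← mul_assoc, ← pow_add, Even.neg_one_pow ⟨r, by ring⟩, one_pow]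
  have := choose_two_cast ((0 + 1) * r + 0)
  push_cast at this ⊢
  rw [hA, hB]
  linarith

theorem XD_sq_eq {s : ℂ} (hs : ‖s‖ < 1) (h0 : s ≠ 0) :
    XD (s ^ 2) = partialTheta 1 1 0 s - partialTheta 1 9 4 s := by
  have h := hasSum_mul_bilatSum (norm_pow_four_lt_one hs) 0
    (norm_thetaWeight_le_one_of_abs_le (k := -1) hs (by norm_num))
  have h1 : HasSum (XDTerm (s ^ 2)) _ := h.congr_fun fun n => by
    rw [XDTerm, show (((0 : ℕ) : ℤ) + 1) = 1 by norm_num, bilatSum_one_odd_neg_eq hs h0, ← pow_mul,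
      ← pow_mul, ← choose_two_succ_mul_two, div_eq_mul_inv]
    ring_nf
  rw [XD, h1.tsum_eq, tsum_thetaWeight_natCast h0 (-1) 1 (by norm_num),
    tsum_thetaWeight_neg_natCast h0 (-1) 9 4 (by norm_num) (by norm_num), sub_eq_add_neg]

theorem chiD_sq_eq {s : ℂ} (hs : ‖s‖ < 1) (h0 : s ≠ 0) :
    chiD (s ^ 2) = partialTheta 1 3 0 s - partialTheta 1 7 2 s := by
  have h := hasSum_mul_bilatSum (norm_pow_four_lt_one hs) 0
    (norm_thetaWeight_le_one_of_abs_le (k := 1) hs (by norm_num))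
  have h1 : HasSum (chiDTerm (s ^ 2)) _ := h.congr_fun fun n => by
    rw [chiDTerm, show (((0 : ℕ) : ℤ) + 1) = 1 by norm_num, (bilatSum_one_eq hs h0 n).2, ← pow_mul,
      ← pow_mul, ← choose_two_succ_mul_two, div_eq_mul_inv]
    ring_nf
  rw [chiD, h1.tsum_eq, tsum_thetaWeight_natCast h0 1 3 (by norm_num),
    tsum_thetaWeight_neg_natCast h0 1 7 2 (by norm_num) (by norm_num), sub_eq_add_neg]

/-! ### Trisection of partial theta series -/

theorem summable_partialTheta {ε q : ℂ} (hε : ‖ε‖ ≤ 1) (hq : ‖q‖ < 1) (A B : ℕ) :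
    Summable fun n : ℕ => ε ^ n * q ^ (5 * n ^ 2 + A * n + B) := by
  refine summable_of_norm_le_mul_pow (norm_nonneg q) hq (C := 1) fun n => ?_
  rw [norm_mul, norm_pow]
  exact mul_le_mul (pow_le_one₀ (norm_nonneg _) hε) (norm_pow_le_pow hq (by nlinarith))
    (norm_nonneg _) zero_le_one

theorem tsum_mul_eq_of_mod_three {c g : ℕ → ℂ} {γ : ℂ} {i : ℕ}
    (h : ∀ n, n % 3 ≠ i → c n = 0) (hγ : ∀ k, c (3 * k + i) = γ) :
    ∑' n, c n * g n = γ * ∑' k, g (3 * k + i) := by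
  have hinj : Function.Injective fun k => 3 * k + i := fun a b hab => by
    simp only at hab
    omega
  rw [← hinj.tsum_eq (f := fun n => c n * g n), ← tsum_mul_left]
  · exact tsum_congr fun k => by rw [hγ]
  · intro n hn
    by_contra hr
    refine hn ?_
    simp only
    rw [h n fun hmod => hr ⟨n / 3, by simp only; omega⟩, zero_mul]

/-- Trisection of a partial theta series: if `5 n² + A n + B` makes the two twists agree off the
residue class `i`, only that class survives. -/
theorem partialTheta_trisect {ε t ω : ℂ} (hε : ‖ε‖ ≤ 1) (ht : ‖t‖ < 1) (hω : ω ^ 3 = 1)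
    {A B : ℕ} (u v i j : ℕ) (hi : i < 3)
    (h : ∀ n, n % 3 ≠ i →
      (u + 2 * (5 * n ^ 2 + A * n + B)) % 3 = (v + (5 * n ^ 2 + A * n + B)) % 3)
    (hj : ∀ n, n % 3 = i → (5 * n ^ 2 + A * n + B) % 3 = j) :
    ω ^ u * partialTheta ε A B (ω ^ 2 * t) - ω ^ v * partialTheta ε A B (ω * t) =
      (ω ^ (u + 2 * j) - ω ^ (v + j)) *
        ∑' k : ℕ, ε ^ (3 * k + i) * t ^ (5 * (3 * k + i) ^ 2 + A * (3 * k + i) + B) := by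
  have hnorm : ‖ω‖ = 1 := by
    have := congrArg norm hω
    rw [norm_pow, norm_one] at this
    exact (pow_eq_one_iff_of_nonneg (norm_nonneg _) three_ne_zero).mp this
  have hs1 := summable_partialTheta hε (q := ω ^ 2 * t) (by simpa [hnorm] using ht) A B
  have hs2 := summable_partialTheta hε (q := ω * t) (by simpa [hnorm] using ht) A B
  rw [partialTheta, partialTheta, ← tsum_mul_left, ← tsum_mul_left,
    ← (hs1.mul_left _).tsum_sub (hs2.mul_left _),
    ← tsum_mul_eq_of_mod_three (g := fun n => ε ^ n * t ^ (5 * n ^ 2 + A * n + B))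
      (c := fun n => ω ^ (u + 2 * (5 * n ^ 2 + A * n + B)) - ω ^ (v + (5 * n ^ 2 + A * n + B)))]
  · refine tsum_congr fun n => ?_
    rw [mul_pow, mul_pow, pow_add ω u, pow_add ω v, pow_mul]
    ring
  · intro n hn
    -- Off the class i, the two powers of ω have exponents congruent mod 3 and cancel.
    rw [pow_eq_pow_mod _ hω, pow_eq_pow_mod (v + _) hω, h n hn, sub_self]
  · intro k
    have hmod := hj (3 * k + i) (by omega)
    rw [pow_eq_pow_mod _ hω, pow_eq_pow_mod (v + (5 * _ + _ + _)) hω, pow_eq_pow_mod (u + 2 * j) hω,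
      pow_eq_pow_mod (v + j) hω]
    congr 2 <;> omega

theorem tsum_trisected {ε t : ℂ} {A B A' B' i d l : ℕ} (hA : 30 * i + 3 * A = 9 * A')
    (hB : 5 * i ^ 2 + A * i + B + l = 9 * B' + d) :
    t ^ l * ∑' k : ℕ, ε ^ (3 * k + i) * t ^ (5 * (3 * k + i) ^ 2 + A * (3 * k + i) + B) =
      ε ^ i * t ^ d * partialTheta (ε ^ 3) A' B' (t ^ 9) := by
  rw [partialTheta, ← tsum_mul_left, ← tsum_mul_left]
  refine tsum_congr fun k => ?_
  have he : 5 * (3 * k + i) ^ 2 + A * (3 * k + i) + B + l =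
      9 * (5 * k ^ 2 + A' * k + B') + d := by
    have : (30 * i + 3 * A) * k = 9 * A' * k := by rw [hA]
    nlinarith
  have : t ^ (5 * (3 * k + i) ^ 2 + A * (3 * k + i) + B) * t ^ l =
      (t ^ 9) ^ (5 * k ^ 2 + A' * k + B') * t ^ d := by
    rw [← pow_mul, ← pow_add, ← pow_add, he]
  rw [← pow_mul ε 3, pow_add]
  linear_combination ε ^ (3 * k) * ε ^ i * this

theorem quadratic_mod_three (A B n : ℕ) :
    5 * n ^ 2 + A * n + B ≡ 5 * (n % 3) ^ 2 + A * (n % 3) + B [MOD 3] := by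
  have h : n ≡ n % 3 [MOD 3] := (Nat.mod_modEq n 3).symm
  exact (((h.pow 2).mul_left 5).add (h.mul_left A)).add_right B

/-- The congruences are required only at residues below 3, so that they are decidable for concrete
parameters. -/
theorem partialTheta_trisection {ε t ω : ℂ} (hε : ‖ε‖ ≤ 1) (ht : ‖t‖ < 1) (hω : ω ^ 3 = 1)
    {A B A' B' : ℕ} (u v i j l d : ℕ) (hi : i < 3)
    (h : ∀ r < 3, r ≠ i →
      (u + 2 * (5 * r ^ 2 + A * r + B)) % 3 = (v + (5 * r ^ 2 + A * r + B)) % 3)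
    (hj : (5 * i ^ 2 + A * i + B) % 3 = j) (hA : 30 * i + 3 * A = 9 * A')
    (hB : 5 * i ^ 2 + A * i + B + l = 9 * B' + d) :
    t ^ l * (ω ^ u * partialTheta ε A B (ω ^ 2 * t) - ω ^ v * partialTheta ε A B (ω * t)) =
      (ω ^ (u + 2 * j) - ω ^ (v + j)) * (ε ^ i * t ^ d * partialTheta (ε ^ 3) A' B' (t ^ 9)) := by
  rw [partialTheta_trisect hε ht hω u v i j hi, mul_left_comm, tsum_trisected hA hB]
  · intro n hn
    have h1 := quadratic_mod_three A B n
    exact ((h1.mul_left 2).add_left u).trans ((h (n % 3) (n.mod_lt three_pos) hn :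
      _ ≡ _ [MOD 3]).trans (h1.symm.add_left v))
  · rintro n rfl
    exact Eq.trans (quadratic_mod_three A B n) hj

/-! ### The four trisections -/

section Trisections

variable {t u ω : ℂ}

theorem norm_mul_lt_one (hω : ω ^ 3 = 1) (ht : ‖t‖ < 1) : ‖ω * t‖ < 1 := by
  have := congrArg norm hω
  rw [norm_pow, norm_one] at this
  rwa [norm_mul, (pow_eq_one_iff_of_nonneg (norm_nonneg _) three_ne_zero).mp this, one_mul]

theorem sq_pow_three (hω : ω ^ 3 = 1) : (ω ^ 2) ^ 3 = 1 := by
  rw [← pow_mul, mul_comm, pow_mul, hω, one_pow]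

theorem ne_zero_of_pow_three (hω : ω ^ 3 = 1) : ω ≠ 0 := by
  rintro rfl
  norm_num at hω

theorem norm_pow_nine_lt_one (ht : ‖t‖ < 1) : ‖t ^ 9‖ < 1 := by
  rw [norm_pow]
  exact pow_lt_one₀ (norm_nonneg _) ht (by norm_num)

theorem phiD_trisection (ht : ‖t‖ < 1) (h0 : t ≠ 0) (hω : ω ^ 3 = 1) :
    t ^ 2 * (psiD (ω ^ 2 * t) - psiD (ω * t)) = (ω - ω ^ 2) * phiD (t ^ 9) := by
  have hω0 := ne_zero_of_pow_three hω
  rw [psiD_eq (norm_mul_lt_one (sq_pow_three hω) ht) (mul_ne_zero (pow_ne_zero 2 hω0) h0),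
    psiD_eq (norm_mul_lt_one hω ht) (mul_ne_zero hω0 h0),
    phiD_eq (norm_pow_nine_lt_one ht) (pow_ne_zero 9 h0)]
  -- The surviving class is n ≡ 1, with exponent ≡ 1 mod 3; the factor t² makes that exponent
  -- divisible by 9.
  have h1 := partialTheta_trisection (ε := -1) (A := 2) (B := 0) (A' := 4) (B' := 1) (by simp) ht hω
    0 0 1 1 2 0 (by decide) (by decide) (by decide) (by decide) (by decide)
  have h2 := partialTheta_trisection (ε := -1) (A := 8) (B := 3) (A' := 6) (B' := 2) (by simp) ht hω
    0 0 1 1 2 0 (by decide) (by decide) (by decide) (by decide) (by decide)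
  norm_num at h1 h2
  linear_combination -h1 - h2

theorem psiD_trisection (ht : ‖t‖ < 1) (h0 : t ≠ 0) (hω : ω ^ 3 = 1) :
    ω * phiD (ω ^ 2 * t) - ω ^ 2 * phiD (ω * t) = -(ω - ω ^ 2) * (t ^ 2 * psiD (t ^ 9)) := by
  have hω0 := ne_zero_of_pow_three hω
  rw [phiD_eq (norm_mul_lt_one (sq_pow_three hω) ht) (mul_ne_zero (pow_ne_zero 2 hω0) h0),
    phiD_eq (norm_mul_lt_one hω ht) (mul_ne_zero hω0 h0),
    psiD_eq (norm_pow_nine_lt_one ht) (pow_ne_zero 9 h0)]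
  have h1 := partialTheta_trisection (ε := -1) (A := 4) (B := 1) (A' := 8) (B' := 3) (by simp) ht hω
    1 2 2 2 0 2 (by decide) (by decide) (by decide) (by decide) (by decide)
  have h2 := partialTheta_trisection (ε := -1) (A := 6) (B := 2) (A' := 2) (B' := 0) (by simp) ht hω
    1 2 0 2 0 2 (by decide) (by decide) (by decide) (by decide) (by decide)
  rw [show 1 + 2 * 2 = 3 + 2 by rfl, show 2 + 2 = 3 + 1 by rfl, pow_add, pow_add, hω] at h1 h2
  norm_num at h1 h2
  linear_combination -h1 - h2

theorem XD_trisection (hu : ‖u‖ < 1) (h0 : u ≠ 0) (hω : ω ^ 3 = 1) :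
    ω * chiD (ω ^ 2 * u ^ 2) - ω ^ 2 * chiD (ω * u ^ 2) = (ω - ω ^ 2) * XD ((u ^ 2) ^ 9) := by
  have hω0 := ne_zero_of_pow_three hω
  have hω2 := sq_pow_three hω
  -- The expansions of X_D and χ_D live at a square root of the argument. As ωu² = (ω²u)², the root
  -- ω² plays the part of ω for u.
  rw [show ω ^ 2 * u ^ 2 = (ω * u) ^ 2 by ring,
    show ω * u ^ 2 = (ω ^ 2 * u) ^ 2 by linear_combination -ω * u ^ 2 * hω,
    show (u ^ 2) ^ 9 = (u ^ 9) ^ 2 by ring,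
    chiD_sq_eq (norm_mul_lt_one hω hu) (mul_ne_zero hω0 h0),
    chiD_sq_eq (norm_mul_lt_one hω2 hu) (mul_ne_zero (pow_ne_zero 2 hω0) h0),
    XD_sq_eq (norm_pow_nine_lt_one hu) (pow_ne_zero 9 h0)]
  have h1 := partialTheta_trisection (ε := 1) (A := 3) (B := 0) (A' := 1) (B' := 0) (by simp) hu hω2
    2 1 0 0 0 0 (by decide) (by decide) (by decide) (by decide) (by decide)
  have h2 := partialTheta_trisection (ε := 1) (A := 7) (B := 2) (A' := 9) (B' := 4) (by simp) hu hω2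
    2 1 2 0 0 0 (by decide) (by decide) (by decide) (by decide) (by decide)
  have hω4 : (ω ^ 2) ^ 2 = ω := by linear_combination ω * hω
  norm_num [hω4] at h1 h2
  linear_combination h1 - h2

theorem chiD_trisection (hu : ‖u‖ < 1) (h0 : u ≠ 0) (hω : ω ^ 3 = 1) :
    XD (ω ^ 2 * u ^ 2) - XD (ω * u ^ 2) =
      -(ω - ω ^ 2) * ((u ^ 2) ^ 2 * chiD ((u ^ 2) ^ 9)) := by
  have hω0 := ne_zero_of_pow_three hω
  have hω2 := sq_pow_three hω
  rw [show ω ^ 2 * u ^ 2 = (ω * u) ^ 2 by ring,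
    show ω * u ^ 2 = (ω ^ 2 * u) ^ 2 by linear_combination -ω * u ^ 2 * hω,
    show (u ^ 2) ^ 9 = (u ^ 9) ^ 2 by ring,
    XD_sq_eq (norm_mul_lt_one hω hu) (mul_ne_zero hω0 h0),
    XD_sq_eq (norm_mul_lt_one hω2 hu) (mul_ne_zero (pow_ne_zero 2 hω0) h0),
    chiD_sq_eq (norm_pow_nine_lt_one hu) (pow_ne_zero 9 h0)]
  have h1 := partialTheta_trisection (ε := 1) (A := 1) (B := 0) (A' := 7) (B' := 2) (by simp) hu hω2
    0 0 2 1 0 4 (by decide) (by decide) (by decide) (by decide) (by decide)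
  have h2 := partialTheta_trisection (ε := 1) (A := 9) (B := 4) (A' := 3) (B' := 0) (by simp) hu hω2
    0 0 0 1 0 4 (by decide) (by decide) (by decide) (by decide) (by decide)
  have hω4 : (ω ^ 2) ^ 2 = ω := by linear_combination ω * hω
  norm_num [hω4] at h1 h2
  linear_combination h1 - h2

end Trisections

end TenthOrderDuals

/-! ### The main theorem -/

theorem mainTheorem8 :
    -- the four series defining the duals converge absolutely in the open unit disc
    (∀ z : ℂ, ‖z‖ < 1 →
      Summable (TenthOrderDuals.phiDTerm z) ∧ Summable (TenthOrderDuals.psiDTerm z) ∧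
      Summable (TenthOrderDuals.XDTerm z) ∧ Summable (TenthOrderDuals.chiDTerm z)) ∧
    -- `t` is any cube root of `q`, so that `q^(1/3) = t`, `q^(2/3) = t^2`, `q^(-2/3) = t^(-2)`
    ∀ (q t ω : ℂ), q ≠ 0 → ‖q‖ < 1 → t ^ 3 = q → IsPrimitiveRoot ω 3 →
      (t ^ (-2 : ℤ) * TenthOrderDuals.phiD (q ^ 3)
        - (TenthOrderDuals.psiD (ω ^ 2 * t) - TenthOrderDuals.psiD (ω * t)) / (ω - ω ^ 2) = 0) ∧
      (t ^ 2 * TenthOrderDuals.psiD (q ^ 3)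
        + (ω * TenthOrderDuals.phiD (ω ^ 2 * t) - ω ^ 2 * TenthOrderDuals.phiD (ω * t))
            / (ω - ω ^ 2) = 0) ∧
      (TenthOrderDuals.XD (q ^ 3)
        - (ω * TenthOrderDuals.chiD (ω ^ 2 * t) - ω ^ 2 * TenthOrderDuals.chiD (ω * t))
            / (ω - ω ^ 2) = 0) ∧
      (TenthOrderDuals.chiD (q ^ 3)
        + t ^ (-2 : ℤ) * ((TenthOrderDuals.XD (ω ^ 2 * t) - TenthOrderDuals.XD (ω * t))
            / (ω - ω ^ 2)) = 0) := by
  refine ⟨fun z hz => ⟨TenthOrderDuals.summable_phiDTerm hz, TenthOrderDuals.summable_psiDTerm hz,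
    TenthOrderDuals.summable_XDTerm hz, TenthOrderDuals.summable_chiDTerm hz⟩, ?_⟩
  rintro q t ω h0 hq rfl hω
  have ht0 : t ≠ 0 := by
    rintro rfl
    exact h0 (by norm_num)
  have ht : ‖t‖ < 1 := by
    rw [norm_pow] at hq
    exact (pow_lt_one_iff_of_nonneg (norm_nonneg t) three_ne_zero).mp hq
  have hω3 := hω.pow_eq_one
  have hd : ω - ω ^ 2 ≠ 0 := by
    rw [show ω - ω ^ 2 = ω * (1 - ω) by ring]
    exact mul_ne_zero (TenthOrderDuals.ne_zero_of_pow_three hω3)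
      (sub_ne_zero.mpr (hω.ne_one (by norm_num)).symm)
  -- Only the X_D and χ_D identities need this square root; any choice serves.
  obtain ⟨u, rfl⟩ : ∃ u : ℂ, t = u ^ 2 := by
    obtain ⟨u, hu⟩ := IsAlgClosed.exists_pow_nat_eq t two_pos
    exact ⟨u, hu.symm⟩
  have hu0 : u ≠ 0 := by
    rintro rfl
    exact ht0 (by norm_num)
  have hu : ‖u‖ < 1 := by
    rw [norm_pow] at ht
    exact (pow_lt_one_iff_of_nonneg (norm_nonneg u) two_ne_zero).mp ht
  have h1 := TenthOrderDuals.phiD_trisection ht ht0 hω3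
  have h2 := TenthOrderDuals.psiD_trisection ht ht0 hω3
  have h3 := TenthOrderDuals.XD_trisection hu hu0 hω3
  have h4 := TenthOrderDuals.chiD_trisection hu hu0 hω3
  have hz : (u ^ 2) ^ (-2 : ℤ) = ((u ^ 2) ^ 2)⁻¹ := by
    rw [zpow_neg]
    norm_cast
  have ht2 : (u ^ 2) ^ 2 ≠ 0 := pow_ne_zero 2 ht0
  rw [show ((u ^ 2) ^ 3) ^ 3 = (u ^ 2) ^ 9 by ring, hz]
  generalize (u ^ 2) ^ 2 = x at *
  refine ⟨?_, ?_, ?_, ?_⟩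
  · rw [sub_eq_zero, eq_div_iff hd, mul_assoc, inv_mul_eq_iff_eq_mul₀ ht2]
    linear_combination -h1
  · rw [h2, neg_mul, neg_div, mul_div_cancel_left₀ _ hd, add_neg_cancel]
  · rw [h3, mul_div_cancel_left₀ _ hd, sub_self]
  · rw [h4, neg_mul, neg_div, mul_div_cancel_left₀ _ hd, mul_neg, inv_mul_cancel_left₀ ht2,
      add_neg_cancel]
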